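/- Let $\Omega$ be a set, $z_0\in\Omega$, and let $E$ be a separable complex Hilbert space. Let $s$ be a reproducing kernel on $\Omega$ of the form $$s_w(z)=\frac{1}{1-\sum_{n\ge 1}u_n(z)\overline{u_n(w)}},$$ where $u(z)=(u_n(z))_{n\ge1}$ lies in the open unit ball of $\ell^2$ for every $z\in\Omega$ and $u(z_0)=0$ (a complete Nevanlinna–Pick kernel normalized at $z_0$), and let $k_w(z)=s_w(z)\,g_w(z)$ with $g$ positive definite on $\Omega$. Let $H_s$, $H_k$ be the Hilbert function spaces with reproducing kernels $s$, $k$, and let $H_k(E)$ be the Hilbert space of $E$-valued functions on $\Omega$ with reproducing kernel $k_w(z)I_E$. $\mathrm{Mult}(H_k)$ is the set of $\varphi:\Omega\to\mathbb C$ such that $f\mapsto\varphi f$ is a bounded operator on $H_k$ (similarly $\mathrm{Mult}(H_s)$), and $\mathrm{Mult}(H_s,H_k(E))$ is the set of $\Phi:\Omega\to E$ such that $h\mapsto h\Phi$ is a bounded operator from $H_s$ to $H_k(E)$. A closed subspace $N$ of $H_k(E)$ is multiplier-invariant if $\varphi N\subset N$ for all $\varphi\in\mathrm{Mult}(H_k)$;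 for $S\subset H_k(E)$ let $[S]$ be the closed linear span of $\{\varphi F:\varphi\in\mathrm{Mult}(H_k),\,F\in S\}$, and $[F]=[\{F\}]$. (1) If $F\in H_k(E)$ and $\|F\|_{H_k(E)}=1$, then there is exactly one pair $(\psi,\Phi)$ with $\psi\in\mathrm{Mult}(H_s)$, $\psi(z_0)=0$, $\Phi\in\mathrm{Mult}(H_s,H_k(E))$, $\|\psi h\|_{H_s}^2+\|h\Phi\|_{H_k(E)}^2\le\|h\|_{H_s}^2$ for all $h\in H_s$, and $F(z)=\frac{1}{1-\psi(z)}\Phi(z)$ for all $z\in\Omega$. For this pair, $\Phi\in H_k(E)$ and $[F]=[\Phi]$. (2) Every multiplier-invariant subspace of $H_k(E)$ is generated by elements of $\mathrm{Mult}(H_s,H_k(E))$: it equals $[S]$ for some set $S\subset H_k(E)$ all of whose elements belong to $\mathrm{Mult}(H_s,H_k(E))$. -/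

import Mathlib

/-- `H` is the reproducing kernel Hilbert space of `V`-valued functions on `Ω` whose reproducing
kernel is `k_w(z) I_V`, where `k z w` stands for `k_w(z)`. For `V = ℂ` this is the scalar space
`H_k`, and for a Hilbert space `V = E` it is `H_k(E)`. -/
def HasKernel {Ω V : Type*} [NormedAddCommGroup V] [InnerProductSpace ℂ V] [CompleteSpace V]
    (H : Type*) [NormedAddCommGroup H] [InnerProductSpace ℂ H] [CompleteSpace H] [RKHS ℂ H Ω V]
    (k : Ω → Ω → ℂ) : Prop :=
  ∀ (z w : Ω) (v : V), RKHS.kernel H z w v = k z w • v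

open scoped ComplexOrder in
/-- `g_w(z) >> 0`: for finitely many points, `∑ i j, conj (a j) * g (z j) (z i) * a i ≥ 0`. -/
def IsPosDefKernel {Ω : Type*} (g : Ω → Ω → ℂ) : Prop :=
  (Matrix.of g).PosSemidef

/-- `s` is a complete Nevanlinna-Pick kernel normalized at `z₀`:
`s_w(z) = 1 / (1 - ∑ n, u_n(z) * conj (u_n(w)))`, where `u(z) = (u_n(z))` is a sequence in the open
unit ball of `ℓ²` and `u(z₀) = 0`. (That `u(z)` is a strict contraction is automatic if `s` is
positive definite.) Note that `inner ℂ x y` is conjugate-linear in `x`. -/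
def IsNormalizedCNP {Ω : Type*} (s : Ω → Ω → ℂ) (z₀ : Ω) : Prop :=
  ∃ u : Ω → lp (fun _ : ℕ => ℂ) 2, u z₀ = 0 ∧ (∀ z, ‖u z‖ < 1) ∧
    ∀ z w, s z w = 1 / (1 - inner ℂ (u w) (u z))

section Multipliers

variable {Ω V : Type*} [NormedAddCommGroup V] [InnerProductSpace ℂ V]

/-- The bounded operator `M : H₁ → H₂` is multiplication by `Φ : Ω → V`, where `H₁` consists of
scalar functions and `H₂` of `V`-valued functions (`B(ℂ, V)` is identified with `V`). -/
def IsMulOp {H₁ H₂ : Type*} [NormedAddCommGroup H₁] [InnerProductSpace ℂ H₁] [RKHS ℂ H₁ Ω ℂ]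
    [NormedAddCommGroup H₂] [InnerProductSpace ℂ H₂] [RKHS ℂ H₂ Ω V]
    (Φ : Ω → V) (M : H₁ →L[ℂ] H₂) : Prop :=
  ∀ (h : H₁) (z : Ω), M h z = h z • Φ z

/-- `Φ ∈ Mult(H₁, H₂)`: multiplication by `Φ` is a bounded operator from `H₁` to `H₂`. With
`H₁ = H₂ = H_k` this is membership in `Mult(H_k)`. -/
def IsMultiplier (H₁ H₂ : Type*) [NormedAddCommGroup H₁] [InnerProductSpace ℂ H₁] [RKHS ℂ H₁ Ω ℂ]
    [NormedAddCommGroup H₂] [InnerProductSpace ℂ H₂] [RKHS ℂ H₂ Ω V] (Φ : Ω → V) : Prop :=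
  ∃ M : H₁ →L[ℂ] H₂, IsMulOp Φ M

/-- `F = Φ / (1 - ψ)` on `Ω`, where `ψ ∈ Mult(H_s)`, `ψ(z₀) = 0`, `Φ ∈ Mult(H_s, H_k(E))` and
`‖ψ h‖² + ‖Φ h‖² ≤ ‖h‖²` for all `h ∈ H_s`. -/
def IsFactorization (Hs : Type*) {HkE : Type*}
    [NormedAddCommGroup Hs] [InnerProductSpace ℂ Hs] [RKHS ℂ Hs Ω ℂ]
    [NormedAddCommGroup HkE] [InnerProductSpace ℂ HkE] [RKHS ℂ HkE Ω V]
    (z₀ : Ω) (F : HkE) (ψ : Ω → ℂ) (Φ : Ω → V) : Prop :=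
  ψ z₀ = 0 ∧
  (∃ (Mψ : Hs →L[ℂ] Hs) (MΦ : Hs →L[ℂ] HkE), IsMulOp ψ Mψ ∧ IsMulOp Φ MΦ ∧
    ∀ h : Hs, ‖Mψ h‖ ^ 2 + ‖MΦ h‖ ^ 2 ≤ ‖h‖ ^ 2) ∧
  ∀ z, F z = (1 / (1 - ψ z)) • Φ z

/-- A closed subspace `N` of `H_k(E)` is multiplier-invariant if `φ N ⊆ N` for all
`φ ∈ Mult(H_k)`. -/
def IsMultInvariant (Hk : Type*) {HkE : Type*}
    [NormedAddCommGroup Hk] [InnerProductSpace ℂ Hk] [RKHS ℂ Hk Ω ℂ]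
    [NormedAddCommGroup HkE] [InnerProductSpace ℂ HkE] [RKHS ℂ HkE Ω V]
    (N : Submodule ℂ HkE) : Prop :=
  IsClosed (N : Set HkE) ∧
    ∀ φ : Ω → ℂ, IsMultiplier Hk Hk φ → ∀ F ∈ N, ∃ G ∈ N, ∀ z, G z = φ z • F z

/-- `[S]`, the multiplier-invariant subspace of `H_k(E)` generated by `S`: the closed linear span of
the functions `φ F` with `φ ∈ Mult(H_k)` and `F ∈ S`. -/
def multSpan (Hk : Type*) {HkE : Type*}
    [NormedAddCommGroup Hk] [InnerProductSpace ℂ Hk] [RKHS ℂ Hk Ω ℂ]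
    [NormedAddCommGroup HkE] [InnerProductSpace ℂ HkE] [RKHS ℂ HkE Ω V]
    (S : Set HkE) : Submodule ℂ HkE :=
  (Submodule.span ℂ {G : HkE | ∃ φ : Ω → ℂ, IsMultiplier Hk Hk φ ∧
    ∃ F ∈ S, ∀ z, G z = φ z • F z}).topologicalClosure

end Multipliers

/-! Everything is encoded in the positivity of one kernel. Write `s z w = 1 / (1 - ⟪b z, b w⟫)` and,
for a unit vector `F`, put `A w = s_w F` and `q z = ⟪A z, F⟫`. As `(1 - ⟪b z, b w⟫) k z w` is
positive definite, the row of multipliers `b` is a contraction `P`, and `A w - P (b w ⊗ A w) = F`.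
Contractivity of `P` together with `‖F‖ = 1` makes `(q z + conj (q w) - 1) s z w - ⟪A z, A w⟫`
positive definite (`exists_kernelBound`).

When `q = 1 / (1 - ψ)` and `F = q Φ`, this positivity is equivalent, by a change of variables, to
contractivity of the column `(ψ, Φ)` (`KernelBound.isFactorization`, `IsFactorization.kernelBound`).
Existence follows with `ψ = 1 - 1/q`, `Φ = F/q`. For uniqueness, the inequality is an equality at
`z₀`, so its first variation there vanishes, which determines `q` (`KernelBound.eq_inner`).

Since `k = s g`, multiplication by `ψ` is also a contraction on `H_k(E)`. It has no nonzero fixed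
vector because `ψ ≠ 1` everywhere, and this recovers `F` from `Φ = (1 - ψ) F` inside any closed
invariant subspace (`mem_of_sub_apply_mem`). Part (2) follows by replacing each normalized element
of `N` by its `Φ`. -/

open scoped InnerProductSpace TensorProduct ComplexConjugate
open RKHS

/-! ### Operators defined on finite sums of kernel functions -/

section KernelMaps

variable {Ω V H : Type*} [NormedAddCommGroup V] [InnerProductSpace ℂ V] [CompleteSpace V]
  [NormedAddCommGroup H] [InnerProductSpace ℂ H] [CompleteSpace H] [RKHS ℂ H Ω V]

variable (H) in
/-- The linear map `e ↦ ∑ z, k_z e(z)` from finitely supported functions to the space. -/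
noncomputable def kerSum : (Ω →₀ V) →ₗ[ℂ] H :=
  Finsupp.lsum ℂ fun z => (kerFun H z).toLinearMap

@[simp]
lemma kerSum_single (z : Ω) (v : V) : kerSum H (Finsupp.single z v) = kerFun H z v := by
  simp [kerSum]

variable (H) in
lemma denseRange_kerSum : DenseRange (kerSum (Ω := Ω) (V := V) H) := by
  have h : Submodule.span ℂ {kerFun H x v | (x : Ω) (v : V)} ≤ LinearMap.range (kerSum H) := by
    rw [Submodule.span_le]
    rintro _ ⟨x, v, rfl⟩
    exact ⟨Finsupp.single x v, kerSum_single x v⟩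
  have h2 := Submodule.topologicalClosure_mono h
  rw [kerFun_dense, top_le_iff] at h2
  have h3 := (Submodule.dense_iff_topologicalClosure_eq_top).2 h2
  rwa [LinearMap.coe_range] at h3

lemma HasKernel.inner_kerFun_kerFun {k : Ω → Ω → ℂ} (hk : HasKernel H k) (z w : Ω) (v v' : V) :
    ⟪kerFun H z v, kerFun H w v'⟫_ℂ = k z w * ⟪v, v'⟫_ℂ := by
  rw [kerFun_inner, kerFun_apply, hk, inner_smul_right]

/-- A linear map on finitely supported functions that is dominated by `kerSum` factors through a
bounded operator. -/
lemma exists_clm_of_norm_le {H' : Type*} [NormedAddCommGroup H'] [InnerProductSpace ℂ H']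
    [CompleteSpace H'] (N : (Ω →₀ V) →ₗ[ℂ] H') {C : ℝ} (hC : 0 ≤ C)
    (h : ∀ e, ‖N e‖ ≤ C * ‖kerSum H e‖) :
    ∃ T : H →L[ℂ] H', ‖T‖ ≤ C ∧ ∀ z v, T (kerFun H z v) = N (Finsupp.single z v) := by
  refine ⟨N.extendOfNorm (kerSum H), LinearMap.opNorm_extendOfNorm_le (denseRange_kerSum H) hC h,
    fun z v => ?_⟩
  rw [← kerSum_single, LinearMap.extendOfNorm_eq (denseRange_kerSum H) ⟨C, h⟩]

end KernelMaps

section Sesquilinear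

variable {ι V W X Y : Type*} [AddCommGroup V] [Module ℂ V] [AddCommGroup W] [Module ℂ W]
  [NormedAddCommGroup X] [InnerProductSpace ℂ X] [NormedAddCommGroup Y] [InnerProductSpace ℂ Y]

/-- By sesquilinearity one-point sums suffice, so isometry claims below reduce to identities between
kernels. -/
lemma inner_eq_inner_of_single {f : (ι →₀ V) →ₗ[ℂ] X} {g : (ι →₀ W) →ₗ[ℂ] X}
    {f' : (ι →₀ V) →ₗ[ℂ] Y} {g' : (ι →₀ W) →ₗ[ℂ] Y}
    (h : ∀ i v j w, ⟪f (.single i v), g (.single j w)⟫_ℂ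
      = ⟪f' (.single i v), g' (.single j w)⟫_ℂ) (x : ι →₀ V) (y : ι →₀ W) :
    ⟪f x, g y⟫_ℂ = ⟪f' x, g' y⟫_ℂ := by
  induction x using Finsupp.induction_linear with
  | zero => simp
  | add x x' hx hx' => simp [hx, hx']
  | single i v =>
    induction y using Finsupp.induction_linear with
    | zero => simp
    | add y y' hy hy' => simp [hy, hy']
    | single j w => exact h i v j w

lemma norm_eq_norm_of_single {f : (ι →₀ V) →ₗ[ℂ] X} {f' : (ι →₀ V) →ₗ[ℂ] Y}
    (h : ∀ i v j w, ⟪f (.single i v), f (.single j w)⟫_ℂ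
      = ⟪f' (.single i v), f' (.single j w)⟫_ℂ) (x : ι →₀ V) : ‖f x‖ = ‖f' x‖ := by
  have := inner_eq_inner_of_single h x x
  rw [inner_self_eq_norm_sq_to_K, inner_self_eq_norm_sq_to_K] at this
  have h2 : ‖f x‖ ^ 2 = ‖f' x‖ ^ 2 := by exact_mod_cast this
  exact (sq_eq_sq₀ (norm_nonneg _) (norm_nonneg _)).1 h2

end Sesquilinear

/-- A positive definite kernel is a Gram kernel. -/
lemma IsPosDefKernel.exists_gram.{u} {Ω : Type u} {g : Ω → Ω → ℂ} (hg : IsPosDefKernel g) :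
    ∃ (G : Type u) (_ : NormedAddCommGroup G) (_ : InnerProductSpace ℂ G) (γ : Ω → G),
      ∀ z w, g z w = ⟪γ z, γ w⟫_ℂ := by
  let K : Matrix Ω Ω (ℂ →L[ℂ] ℂ) := .of fun z w => g z w • ContinuousLinearMap.id ℂ ℂ
  have hherm (z w : Ω) : conj (g w z) = g z w := hg.1.apply z w
  have hK : K.PosSemidef := by
    have htfae := (posSemidef_tfae (K := K)).out 0 2
    refine htfae.2 ⟨?_, fun vv => ?_⟩
    · ext z w
      have h1 : star (ContinuousLinearMap.id ℂ ℂ) = ContinuousLinearMap.id ℂ ℂ :=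
        star_one (ℂ →L[ℂ] ℂ)
      simp [K, Matrix.conjTranspose_apply, hherm, h1]
    · have := (Complex.le_def.1 (hg.2 vv)).1
      refine this.trans_eq (congrArg Complex.re ?_)
      refine Finset.sum_congr rfl fun i _ => Finset.sum_congr rfl fun j _ => ?_
      simp [K, hherm]
      ring
  have : Fact K.PosSemidef := ⟨hK⟩
  refine ⟨OfKernel K, inferInstance, inferInstance, fun z => kerFun (OfKernel K) z 1,
    fun z w => ?_⟩
  rw [kerFun_inner, kerFun_apply, OfKernel.kernel_ofKernel]
  simp [K]

/-! ### Multipliers and their adjoints on kernel functions -/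

section Multipliers

variable {Ω V : Type*} [NormedAddCommGroup V] [InnerProductSpace ℂ V]
  {H₁ H₂ : Type*} [NormedAddCommGroup H₁] [InnerProductSpace ℂ H₁]
  [RKHS ℂ H₁ Ω ℂ] [NormedAddCommGroup H₂] [InnerProductSpace ℂ H₂] [RKHS ℂ H₂ Ω V]

lemma IsMulOp.comp {φ : Ω → ℂ} {ψ : Ω → V} {M : H₁ →L[ℂ] H₁} {N : H₁ →L[ℂ] H₂}
    (hM : IsMulOp φ M) (hN : IsMulOp ψ N) : IsMulOp (fun z => φ z • ψ z) (N.comp M) := by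
  intro h z
  simp [hN _ z, hM _ z, smul_smul]

variable [CompleteSpace V] [CompleteSpace H₁] [CompleteSpace H₂]

lemma IsMulOp.inner_kerFun_one {Φ : Ω → V} {M : H₁ →L[ℂ] H₂}
    (hM : IsMulOp Φ M) (z : Ω) (v : V) (h : H₁) :
    ⟪kerFun H₂ z v, M h⟫_ℂ = ⟪⟪Φ z, v⟫_ℂ • kerFun H₁ z (1 : ℂ), h⟫_ℂ := by
  rw [kerFun_inner, hM, inner_smul_left, kerFun_inner, inner_smul_right, inner_conj_symm]
  simp [mul_comm]

lemma IsMulOp.adjoint_kerFun {Φ : Ω → V} {M : H₁ →L[ℂ] H₂}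
    (hM : IsMulOp Φ M) (z : Ω) (v : V) :
    M.adjoint (kerFun H₂ z v) = ⟪Φ z, v⟫_ℂ • kerFun H₁ z (1 : ℂ) := by
  refine ext_inner_right ℂ fun h => ?_
  rw [ContinuousLinearMap.adjoint_inner_left, hM.inner_kerFun_one]

end Multipliers

section

variable {Ω V H₁ H G : Type*} [NormedAddCommGroup V] [InnerProductSpace ℂ V] [CompleteSpace V]
  [NormedAddCommGroup H₁] [InnerProductSpace ℂ H₁] [CompleteSpace H₁] [RKHS ℂ H₁ Ω ℂ]
  [NormedAddCommGroup H] [InnerProductSpace ℂ H] [CompleteSpace H] [RKHS ℂ H Ω V]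
  [NormedAddCommGroup G] [InnerProductSpace ℂ G]

/-- A multiplier of a scalar space is a multiplier, of no larger norm, of every space whose kernel
is the product of the scalar kernel with an operator-valued Gram kernel. -/
lemma IsMulOp.exists_isMulOp_of_factor {s k : Ω → Ω → ℂ} (hs : HasKernel H₁ s)
    (hk : HasKernel H k) {δ : Ω → V →ₗ[ℂ] G}
    (hδ : ∀ z w v v', k z w * ⟪v, v'⟫_ℂ = s z w * ⟪δ z v, δ w v'⟫_ℂ)
    {ψ : Ω → ℂ} {M : H₁ →L[ℂ] H₁} (hM : IsMulOp ψ M) :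
    ∃ M' : H →L[ℂ] H, ‖M'‖ ≤ ‖M‖ ∧ ∀ (f : H) (z : Ω), M' f z = ψ z • f z := by
  -- `k_z v ↦ s_z ⊗ δ z v` is isometric, and the candidate adjoint `N` has the same norms as `M* ⊗
  -- 1` composed with it.
  let J : (Ω →₀ V) →ₗ[ℂ] H₁ ⊗[ℂ] G :=
    Finsupp.lsum ℂ fun z => (TensorProduct.mk ℂ H₁ G (kerFun H₁ z (1 : ℂ))) ∘ₗ δ z
  let N : (Ω →₀ V) →ₗ[ℂ] H := Finsupp.lsum ℂ fun z => conj (ψ z) • (kerFun H z).toLinearMap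
  have hN (e : Ω →₀ V) : ‖N e‖ = ‖((M.adjoint.rTensor G).toLinearMap ∘ₗ J) e‖ := by
    refine norm_eq_norm_of_single (Y := H₁ ⊗[ℂ] G) (f := N)
      (f' := (M.adjoint.rTensor G).toLinearMap ∘ₗ J) (fun z v w v' => ?_) e
    simp [N, J, hM.adjoint_kerFun, inner_smul_left, inner_smul_right, -kerFun_inner, -inner_kerFun,
      hk.inner_kerFun_kerFun, hs.inner_kerFun_kerFun, hδ]
    ring
  have hJ (e : Ω →₀ V) : ‖J e‖ = ‖kerSum H e‖ := by
    refine norm_eq_norm_of_single (X := H₁ ⊗[ℂ] G) (f := J) (f' := kerSum H)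
      (fun z v w v' => ?_) e
    simp [J, -kerFun_inner, -inner_kerFun,
      hk.inner_kerFun_kerFun, hs.inner_kerFun_kerFun, hδ]
  obtain ⟨T, hT, hTk⟩ := exists_clm_of_norm_le N (norm_nonneg M) fun e => by
    rw [hN, ← hJ]
    refine (ContinuousLinearMap.le_opNorm (M.adjoint.rTensor G) (J e)).trans ?_
    gcongr
    refine (ContinuousLinearMap.norm_rTensor_le _ _).trans_eq ?_
    simp
  refine ⟨T.adjoint, by simpa using hT, fun f z => ext_inner_left ℂ fun v => ?_⟩
  rw [← kerFun_inner, ContinuousLinearMap.adjoint_inner_right, hTk]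
  simp [N, inner_smul_left, inner_smul_right]

lemma IsMulOp.exists_isMulOp_of_kernel_mul {s k : Ω → Ω → ℂ} (hs : HasKernel H₁ s)
    (hk : HasKernel H k) {γ : Ω → G} (hγ : ∀ z w, k z w = s z w * ⟪γ z, γ w⟫_ℂ)
    {ψ : Ω → ℂ} {M : H₁ →L[ℂ] H₁} (hM : IsMulOp ψ M) :
    ∃ M' : H →L[ℂ] H, ‖M'‖ ≤ ‖M‖ ∧ ∀ (f : H) (z : Ω), M' f z = ψ z • f z :=
  hM.exists_isMulOp_of_factor (δ := fun z => TensorProduct.mk ℂ G V (γ z)) hs hk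
    fun z w v v' => by simp [hγ, mul_assoc]

/-- If `(1 - ⟪b z, b w⟫) k` is positive definite, then multiplication by the row with entries the
coordinates of `b` is a contraction. -/
lemma exists_row_contraction {B : Type*} [NormedAddCommGroup B] [InnerProductSpace ℂ B]
    {k : Ω → Ω → ℂ} (hk : HasKernel H k) {b : Ω → B} {γ : Ω → G}
    (hb : ∀ z w, k z w * (1 - ⟪b z, b w⟫_ℂ) = ⟪γ z, γ w⟫_ℂ) :
    ∃ P : B ⊗[ℂ] H →L[ℂ] H, ‖P‖ ≤ 1 ∧ ∀ (a : B) (f : H) (z : Ω),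
      P (a ⊗ₜ f) z = ⟪b z, a⟫_ℂ • f z := by
  -- `k_z v ↦ (b z ⊗ k_z v, γ z ⊗ v)` is isometric by `hb`, so its first component is contractive;
  -- `P` is the adjoint of that component.
  let R : (Ω →₀ V) →ₗ[ℂ] B ⊗[ℂ] H :=
    Finsupp.lsum ℂ fun z => (TensorProduct.mk ℂ B H (b z)) ∘ₗ (kerFun H z).toLinearMap
  let D : (Ω →₀ V) →ₗ[ℂ] G ⊗[ℂ] V := Finsupp.lsum ℂ fun z => TensorProduct.mk ℂ G V (γ z)
  let RD : (Ω →₀ V) →ₗ[ℂ] WithLp 2 ((B ⊗[ℂ] H) × (G ⊗[ℂ] V)) :=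
    (WithLp.linearEquiv 2 ℂ _).symm.toLinearMap ∘ₗ R.prod D
  have hRD (e : Ω →₀ V) : ‖RD e‖ = ‖kerSum H e‖ := by
    refine norm_eq_norm_of_single (X := WithLp 2 ((B ⊗[ℂ] H) × (G ⊗[ℂ] V))) (f := RD)
      (f' := kerSum H) (fun z v w v' => ?_) e
    simp [RD, R, D, -kerFun_inner, -inner_kerFun, hk.inner_kerFun_kerFun, ← hb]
    ring
  have hR (e : Ω →₀ V) : ‖R e‖ ≤ ‖kerSum H e‖ := by
    rw [← hRD]
    exact WithLp.norm_fst_le _ (RD e)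
  -- The algebraic tensor product need not be complete, so the adjoint is taken on its completion.
  let ι : B ⊗[ℂ] H →L[ℂ] UniformSpace.Completion (B ⊗[ℂ] H) := UniformSpace.Completion.toComplL
  obtain ⟨T, hT, hTk⟩ := exists_clm_of_norm_le (ι.toLinearMap ∘ₗ R) zero_le_one fun e => by
    simpa [ι] using hR e
  refine ⟨T.adjoint.comp ι, ?_, fun a f z => ext_inner_left ℂ fun v => ?_⟩
  · refine ContinuousLinearMap.opNorm_le_bound _ zero_le_one fun x => ?_
    refine (T.adjoint.le_opNorm (ι x)).trans ?_
    have : ‖ι x‖ = ‖x‖ := UniformSpace.Completion.norm_coe x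
    rw [this, LinearIsometryEquiv.norm_map]
    gcongr
  · rw [← kerFun_inner, ContinuousLinearMap.comp_apply, ContinuousLinearMap.adjoint_inner_right,
      hTk]
    simp [ι, R, inner_smul_right]

end

/-! ### Positivity of the kernel attached to a unit vector -/

section Positivity

variable {Ω S C H : Type*} [NormedAddCommGroup S] [InnerProductSpace ℂ S]
  [NormedAddCommGroup C] [InnerProductSpace ℂ C] [NormedAddCommGroup H] [InnerProductSpace ℂ H]

/-- The kernel `(q z + conj (q w) - 1) ⟪σ z, σ w⟫ - ⟪A z, A w⟫` with `q z = ⟪A z, F⟫` is positive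
definite, in the form of an inequality for finite sums. -/
lemma norm_sq_linearCombination_le {σ : Ω → S} {ξ : Ω → C} {A : Ω → H} {P : C →L[ℂ] H}
    (hP : ‖P‖ ≤ 1) {F : H} (hF : ‖F‖ = 1) (hA : ∀ w, A w - P (ξ w) = F)
    (hσ : ∀ z w, ⟪σ z, σ w⟫_ℂ * (⟪A z, A w⟫_ℂ - ⟪ξ z, ξ w⟫_ℂ) = ⟪A z, A w⟫_ℂ) (x : Ω →₀ ℂ) :
    ‖Finsupp.linearCombination ℂ A x‖ ^ 2 ≤
      2 * (⟪Finsupp.linearCombination ℂ (fun z => ⟪F, A z⟫_ℂ • σ z) x,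
        Finsupp.linearCombination ℂ σ x⟫_ℂ).re - ‖Finsupp.linearCombination ℂ σ x‖ ^ 2 := by
  set X := Finsupp.linearCombination ℂ σ
  set Y := Finsupp.linearCombination ℂ A
  set Q := Finsupp.linearCombination ℂ (fun z => ⟪F, A z⟫_ℂ • σ z)
  let Z : (Ω →₀ ℂ) →ₗ[ℂ] S ⊗[ℂ] C := Finsupp.linearCombination ℂ (fun z => σ z ⊗ₜ ξ z)
  let PZ : (Ω →₀ ℂ) →ₗ[ℂ] S ⊗[ℂ] H := (P.lTensor S).toLinearMap ∘ₗ Z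
  have hFF : ⟪F, F⟫_ℂ = 1 := by rw [inner_self_eq_norm_sq_to_K, hF]; simp
  -- Expand `P (ξ z) = A z - F` using `‖F‖ = 1`: the kernel in question equals `⟪σ z, σ w⟫ (⟪ξ z, ξ
  -- w⟫ - ⟪P (ξ z), P (ξ w)⟫)`, positive because `1 ⊗ P` is contractive.
  have key (x y : Ω →₀ ℂ) : ⟪Q x, X y⟫_ℂ + ⟪X x, Q y⟫_ℂ - ⟪X x, X y⟫_ℂ
      = ⟪Y x, Y y⟫_ℂ + ⟪Z x, Z y⟫_ℂ - ⟪PZ x, PZ y⟫_ℂ := by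
    induction x using Finsupp.induction_linear with
    | zero => simp
    | add x x' hx hx' =>
      simp only [map_add, inner_add_left]
      linear_combination hx + hx'
    | single z c =>
      induction y using Finsupp.induction_linear with
      | zero => simp
      | add y y' hy hy' =>
        simp only [map_add, inner_add_right]
        linear_combination hy + hy'
      | single w d =>
        have h1 (w : Ω) : P (ξ w) = A w - F := by rw [← hA w]; abel
        have h2 (z : Ω) (c : ℂ) : PZ (.single z c) = (c • σ z) ⊗ₜ (A z - F) := by
          simp [PZ, Z, h1, TensorProduct.smul_tmul']
        have h3 (z : Ω) (c : ℂ) : Z (.single z c) = (c • σ z) ⊗ₜ ξ z := by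
          simp [Z, TensorProduct.smul_tmul']
        rw [h2, h2, h3, h3, TensorProduct.inner_tmul, TensorProduct.inner_tmul]
        simp only [Q, X, Y, Finsupp.linearCombination_single, inner_smul_left,
          inner_smul_right, inner_sub_left, inner_sub_right, hFF, inner_conj_symm]
        linear_combination conj c * d * hσ z w
  have hZ : ‖PZ x‖ ≤ ‖Z x‖ := by
    refine ((P.lTensor S).le_opNorm (Z x)).trans ?_
    exact mul_le_of_le_one_left (norm_nonneg _) ((ContinuousLinearMap.norm_lTensor_le _ P).trans hP)
  have hre := congrArg Complex.re (key x x)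
  have hsymm : (⟪X x, Q x⟫_ℂ).re = (⟪Q x, X x⟫_ℂ).re := by
    rw [← inner_conj_symm, Complex.conj_re]
  simp only [Complex.add_re, Complex.sub_re, hsymm] at hre
  rw [inner_self_eq_norm_sq_to_K (X x), inner_self_eq_norm_sq_to_K (Y x),
    inner_self_eq_norm_sq_to_K (Z x), inner_self_eq_norm_sq_to_K (PZ x)] at hre
  have hc (r : ℝ) : ((((r : ℝ) : ℂ)) ^ 2).re = r ^ 2 := by norm_cast
  simp only [Complex.coe_algebraMap, hc] at hre
  have : ‖PZ x‖ ^ 2 ≤ ‖Z x‖ ^ 2 := by gcongr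
  linarith

/-- A vector that is nonnegative to first order in every direction has no first order term. -/
lemma eq_zero_of_forall_re_mul_add_nonneg {p : ℂ} {c : ℝ}
    (h : ∀ t : ℂ, 0 ≤ (t * p).re + ‖t‖ ^ 2 * c) : p = 0 := by
  by_contra hp
  have hp' : 0 < ‖p‖ ^ 2 := by positivity
  set ε : ℝ := 1 / (2 * (|c| + 1)) with hε
  have hε0 : 0 < ε := by positivity
  -- This direction gives `-ε ‖p‖² (1 - ε c)`, negative because `ε` is chosen with `ε c < 1`.
  have h1 := h (-(ε : ℂ) * conj p)
  have h2 : ((-(ε : ℂ) * conj p) * p).re = -ε * ‖p‖ ^ 2 := by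
    rw [mul_assoc, Complex.conj_mul']
    norm_cast
  have h3 : ‖-(ε : ℂ) * conj p‖ ^ 2 = ε ^ 2 * ‖p‖ ^ 2 := by
    simp [mul_pow]
  rw [h2, h3] at h1
  have h4 : ε * c < 1 := by
    have : ε * (2 * (|c| + 1)) = 1 := by rw [hε]; field_simp
    nlinarith [le_abs_self c, abs_nonneg c]
  nlinarith [mul_pos hε0 hp']

lemma norm_add_sq_sub_eq {u v c y : S} (hu : u = c - y) :
    ‖u + v‖ ^ 2 - ‖u‖ ^ 2 = ‖v‖ ^ 2 + 2 * (⟪c, v⟫_ℂ).re - 2 * (⟪y, v⟫_ℂ).re := by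
  have h := norm_add_sq (𝕜 := ℂ) u v
  have h2 : RCLike.re ⟪u, v⟫_ℂ = (⟪c, v⟫_ℂ).re - (⟪y, v⟫_ℂ).re := by
    rw [hu, inner_sub_left]; rfl
  rw [h2] at h
  linarith

end Positivity

/-! ### Contractive columns tested on kernel sums -/

section Factorization

variable {Ω E Hs HkE : Type*}
  [NormedAddCommGroup E] [InnerProductSpace ℂ E]
  [NormedAddCommGroup Hs] [InnerProductSpace ℂ Hs] [CompleteSpace Hs] [RKHS ℂ Hs Ω ℂ]

variable (Hs) in
/-- The formal adjoint `k_z e ↦ ⟪Φ z, e⟫ s_z` of multiplication by `Φ`, on finite sums. -/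
noncomputable def adjMul (Φ : Ω → E) : (Ω →₀ E) →ₗ[ℂ] Hs :=
  Finsupp.lsum ℂ fun z =>
    (LinearMap.toSpanSingleton ℂ Hs (kerFun Hs z (1 : ℂ))) ∘ₗ (innerSL ℂ (Φ z)).toLinearMap

@[simp]
lemma adjMul_single (Φ : Ω → E) (z : Ω) (v : E) :
    adjMul Hs Φ (Finsupp.single z v) = ⟪Φ z, v⟫_ℂ • kerFun Hs z (1 : ℂ) := by
  simp [adjMul]

variable [CompleteSpace E]
  [NormedAddCommGroup HkE] [InnerProductSpace ℂ HkE] [CompleteSpace HkE] [RKHS ℂ HkE Ω E]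

/-- The contractivity of a column of multipliers, in terms of kernel functions. -/
lemma exists_column_contraction {ψ : Ω → ℂ} {Φ : Ω → E}
    (h : ∀ (a : Ω →₀ ℂ) (e : Ω →₀ E),
      ‖adjMul Hs ψ a + adjMul Hs Φ e‖ ^ 2 ≤ ‖kerSum Hs a‖ ^ 2 + ‖kerSum HkE e‖ ^ 2) :
    ∃ (Mψ : Hs →L[ℂ] Hs) (MΦ : Hs →L[ℂ] HkE), IsMulOp ψ Mψ ∧ IsMulOp Φ MΦ ∧
      ∀ h : Hs, ‖Mψ h‖ ^ 2 + ‖MΦ h‖ ^ 2 ≤ ‖h‖ ^ 2 := by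
  let L : ((Ω →₀ ℂ) × (Ω →₀ E)) →ₗ[ℂ] WithLp 2 (Hs × HkE) :=
    (WithLp.linearEquiv 2 ℂ _).symm.toLinearMap ∘ₗ (kerSum Hs).prodMap (kerSum HkE)
  let N : ((Ω →₀ ℂ) × (Ω →₀ E)) →ₗ[ℂ] Hs := (adjMul Hs ψ).coprod (adjMul Hs Φ)
  have hL : DenseRange L := by
    have h1 : DenseRange (Prod.map (kerSum (Ω := Ω) (V := ℂ) Hs) (kerSum (Ω := Ω) (V := E) HkE)) :=
      (denseRange_kerSum Hs).prodMap (denseRange_kerSum HkE)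
    exact (WithLp.homeomorphProd 2 Hs HkE).symm.surjective.denseRange.comp h1
      (WithLp.homeomorphProd 2 Hs HkE).symm.continuous
  have hN (p) : ‖N p‖ ≤ 1 * ‖L p‖ := by
    rw [one_mul, ← sq_le_sq₀ (norm_nonneg _) (norm_nonneg _), WithLp.prod_norm_sq_eq_of_L2]
    exact h p.1 p.2
  let T : WithLp 2 (Hs × HkE) →L[ℂ] Hs := N.extendOfNorm L
  have hT : ‖T‖ ≤ 1 := LinearMap.opNorm_extendOfNorm_le hL zero_le_one hN
  have hTL (p) : T (L p) = N p := LinearMap.extendOfNorm_eq hL ⟨1, hN⟩ p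
  refine ⟨(WithLp.fstL 2 ℂ Hs HkE).comp T.adjoint, (WithLp.sndL 2 ℂ Hs HkE).comp T.adjoint,
    fun f z => ?_, fun f z => ext_inner_left ℂ fun v => ?_, fun f => ?_⟩
  · have h1 := ContinuousLinearMap.adjoint_inner_right T (L (Finsupp.single z 1, 0)) f
    rw [hTL] at h1
    simpa [L, N, inner_smul_left, mul_comm] using h1
  · have h1 := ContinuousLinearMap.adjoint_inner_right T (L (0, Finsupp.single z v)) f
    rw [hTL] at h1
    simpa [L, N, inner_smul_left, inner_smul_right, mul_comm] using h1
  · have h1 : ‖T.adjoint f‖ ≤ ‖f‖ := by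
      refine (T.adjoint.le_opNorm f).trans ?_
      rw [LinearIsometryEquiv.norm_map]
      exact mul_le_of_le_one_left (norm_nonneg _) hT
    have h2 := WithLp.prod_norm_sq_eq_of_L2 (T.adjoint f)
    have h3 : ‖T.adjoint f‖ ^ 2 ≤ ‖f‖ ^ 2 := by gcongr
    rw [h2] at h3
    exact h3

lemma IsMulOp.inner_adjMul {Φ : Ω → E} {M : Hs →L[ℂ] HkE} (hM : IsMulOp Φ M) (e : Ω →₀ E)
    (f : Hs) : ⟪adjMul Hs Φ e, f⟫_ℂ = ⟪kerSum HkE e, M f⟫_ℂ := by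
  induction e using Finsupp.induction_linear with
  | zero => simp
  | add e e' he he' => simp [he, he']
  | single z v => rw [adjMul_single, kerSum_single, hM.inner_kerFun_one]

/-- The adjoint of a contractive column is a contractive row; this is the converse of
`exists_column_contraction`. -/
lemma norm_sq_adjMul_add_le {ψ : Ω → ℂ} {Φ : Ω → E} {Mψ : Hs →L[ℂ] Hs} {MΦ : Hs →L[ℂ] HkE}
    (hψ : IsMulOp ψ Mψ) (hΦ : IsMulOp Φ MΦ)
    (h : ∀ h : Hs, ‖Mψ h‖ ^ 2 + ‖MΦ h‖ ^ 2 ≤ ‖h‖ ^ 2) (a : Ω →₀ ℂ) (e : Ω →₀ E) :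
    ‖adjMul Hs ψ a + adjMul Hs Φ e‖ ^ 2 ≤ ‖kerSum Hs a‖ ^ 2 + ‖kerSum HkE e‖ ^ 2 := by
  set f := adjMul Hs ψ a + adjMul Hs Φ e with hf
  have h1 : ⟪f, f⟫_ℂ = ⟪kerSum Hs a, Mψ f⟫_ℂ + ⟪kerSum HkE e, MΦ f⟫_ℂ := by
    nth_rw 1 [hf]
    rw [inner_add_left, hψ.inner_adjMul, hΦ.inner_adjMul]
  have h2 : ‖f‖ ^ 2 = (⟪kerSum Hs a, Mψ f⟫_ℂ).re + (⟪kerSum HkE e, MΦ f⟫_ℂ).re := by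
    rw [← Complex.add_re, ← h1]
    exact (inner_self_eq_norm_sq (𝕜 := ℂ) f).symm
  have h3 : (⟪kerSum Hs a, Mψ f⟫_ℂ).re ≤ ‖kerSum Hs a‖ * ‖Mψ f‖ := re_inner_le_norm (𝕜 := ℂ) _ _
  have h4 : (⟪kerSum HkE e, MΦ f⟫_ℂ).re ≤ ‖kerSum HkE e‖ * ‖MΦ f‖ := re_inner_le_norm (𝕜 := ℂ) _ _
  nlinarith [h f, sq_nonneg (‖kerSum Hs a‖ - ‖Mψ f‖), sq_nonneg (‖kerSum HkE e‖ - ‖MΦ f‖)]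

end Factorization

/-! ### Two facts about contractions on Hilbert space -/

section Abstract

variable {H : Type*} [NormedAddCommGroup H] [InnerProductSpace ℂ H]

/-- `G ↦ P (b w ⊗ G)` has norm below `1`, so `1` minus it is invertible. With `P` the row
contraction, `A w` is `s_w F`. -/
lemma exists_sub_apply_tmul_eq [CompleteSpace H] {Ω B : Type*} [NormedAddCommGroup B]
    [InnerProductSpace ℂ B] {P : B ⊗[ℂ] H →L[ℂ] H} (hP : ‖P‖ ≤ 1) {b : Ω → B}
    (hb : ∀ z, ‖b z‖ < 1) (F : H) : ∃ A : Ω → H, ∀ w, A w - P (b w ⊗ₜ A w) = F := by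
  have (w : Ω) : ∃ G : H, G - P (b w ⊗ₜ G) = F := by
    let T : H →L[ℂ] H := P.comp (TensorProduct.mkL ℂ B H (b w))
    have hT : ‖T‖ < 1 := by
      refine lt_of_le_of_lt (ContinuousLinearMap.opNorm_le_bound _ (norm_nonneg (b w)) fun G => ?_)
        (hb w)
      refine (P.le_opNorm (b w ⊗ₜ G)).trans ?_
      rw [TensorProduct.norm_tmul]
      exact mul_le_of_le_one_left (by positivity) hP
    obtain ⟨U, hU⟩ := isUnit_one_sub_of_norm_lt_one hT
    refine ⟨(↑U⁻¹ : H →L[ℂ] H) F, ?_⟩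
    have h1 : ((1 : H →L[ℂ] H) - T) ((↑U⁻¹ : H →L[ℂ] H) F) = F := by
      rw [← hU, ← mul_apply_eq_comp, Units.mul_inv]
      rfl
    exact h1
  choose A hA using this
  exact ⟨A, hA⟩

/-- If a closed subspace is invariant under a contraction `T` without nonzero fixed vectors, then
it contains `F` as soon as it contains `F - T F`. -/
lemma mem_of_sub_apply_mem [CompleteSpace H] {T : H →L[ℂ] H} (hT : ‖T‖ ≤ 1)
    (hfix : ∀ G, T G = G → G = 0) {N : Submodule ℂ H} (hN : IsClosed (N : Set H))
    (hTN : ∀ G ∈ N, T G ∈ N) {F : H} (hF : F - T F ∈ N) : F ∈ N := by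
  have : CompleteSpace N := hN.completeSpace_coe
  obtain ⟨y, hy, G, hG, rfl⟩ := N.exists_add_mem_mem_orthogonal F
  have hGT : G - T G ∈ N := by
    have h1 : G - T G = (y + G - T (y + G)) - (y - T y) := by rw [map_add]; abel
    rw [h1]
    exact N.sub_mem hF (N.sub_mem hy (hTN y hy))
  -- `G ⊥ N` and `G - T G ∈ N`; equality in Cauchy–Schwarz for the contraction `T` then forces `T G
  -- = G`.
  have h2 : ⟪T G, G⟫_ℂ = ⟪G, G⟫_ℂ := by
    have := hG _ hGT
    rw [inner_sub_left, sub_eq_zero] at this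
    exact this.symm
  have h3 : T G = G := by
    refine eq_of_norm_le_re_inner_eq_norm_sq (𝕜 := ℂ) ?_ ?_
    · simpa using T.le_of_opNorm_le hT G
    · rw [h2, inner_self_eq_norm_sq]
  rw [hfix G h3, add_zero]
  exact hy

end Abstract

/-! ### Invariant subspaces, and why `ψ` omits the value `1` -/

section Multipliers

variable {Ω V Hs Hk H : Type*} [NormedAddCommGroup V] [InnerProductSpace ℂ V]
  [NormedAddCommGroup Hs] [InnerProductSpace ℂ Hs] [CompleteSpace Hs] [RKHS ℂ Hs Ω ℂ]
  [NormedAddCommGroup Hk] [InnerProductSpace ℂ Hk] [RKHS ℂ Hk Ω ℂ]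
  [NormedAddCommGroup H] [InnerProductSpace ℂ H] [RKHS ℂ H Ω V]

lemma isMultiplier_one : IsMultiplier Hk Hk (fun _ : Ω => (1 : ℂ)) :=
  ⟨ContinuousLinearMap.id ℂ Hk, fun h z => by simp⟩

lemma IsMultiplier.mul {φ ψ : Ω → ℂ} (hφ : IsMultiplier Hk Hk φ) (hψ : IsMultiplier Hk Hk ψ) :
    IsMultiplier Hk Hk (fun z => φ z * ψ z) := by
  obtain ⟨M, hM⟩ := hφ
  obtain ⟨N, hN⟩ := hψ
  exact ⟨N.comp M, hM.comp hN⟩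

lemma IsMultiplier.one_sub {φ : Ω → ℂ} (hφ : IsMultiplier Hk Hk φ) :
    IsMultiplier Hk Hk (fun z => 1 - φ z) := by
  obtain ⟨M, hM⟩ := hφ
  refine ⟨ContinuousLinearMap.id ℂ Hk - M, fun h z => ?_⟩
  simp [hM h z]
  ring

lemma subset_multSpan (S : Set H) : S ⊆ (multSpan Hk S : Set H) := fun F hF =>
  Submodule.le_topologicalClosure _ (Submodule.subset_span
    ⟨fun _ => 1, isMultiplier_one, F, hF, fun z => by simp⟩)

lemma multSpan_le {S : Set H} {N : Submodule ℂ H} (hN : IsMultInvariant Hk N)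
    (hS : S ⊆ (N : Set H)) : multSpan Hk S ≤ N := by
  refine Submodule.topologicalClosure_minimal _ (Submodule.span_le.2 ?_) hN.1
  rintro G ⟨φ, hφ, F, hF, hG⟩
  obtain ⟨G', hG', h⟩ := hN.2 φ hφ F (hS hF)
  rwa [show G = G' from RKHS.ext fun z => (hG z).trans (h z).symm]

/-- `multSpan` is invariant if every multiplier of the scalar space acts on the vector-valued
space. -/
lemma isMultInvariant_multSpan (h : ∀ φ : Ω → ℂ, IsMultiplier Hk Hk φ →
      ∃ T : H →L[ℂ] H, ∀ (f : H) (z : Ω), T f z = φ z • f z) (S : Set H) :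
    IsMultInvariant Hk (multSpan Hk S) := by
  refine ⟨Submodule.isClosed_topologicalClosure _, fun φ hφ F hF => ?_⟩
  obtain ⟨T, hT⟩ := h φ hφ
  refine ⟨T F, ?_, hT F⟩
  refine map_mem_closure T.continuous hF fun G hG => ?_
  induction hG using Submodule.span_induction with
  | mem G hG =>
    obtain ⟨χ, hχ, F', hF', hG⟩ := hG
    exact Submodule.subset_span ⟨_, hφ.mul hχ, F', hF', fun z => by rw [hT, hG, smul_smul]⟩
  | zero => simp
  | add G G' _ _ hG hG' => rw [map_add]; exact Submodule.add_mem _ hG hG'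
  | smul c G _ hG => rw [map_smul]; exact Submodule.smul_mem _ c hG

/-- A contractive multiplier that vanishes at a point where the kernel is normalized does not
take the value `1`. -/
lemma IsMulOp.ne_one {s : Ω → Ω → ℂ} (hs : HasKernel Hs s) {z₀ : Ω} (hs₀ : ∀ w, s z₀ w = 1)
    {ψ : Ω → ℂ} {M : Hs →L[ℂ] Hs} (hM : IsMulOp ψ M) (hM1 : ∀ h, ‖M h‖ ≤ ‖h‖) (h₀ : ψ z₀ = 0)
    (z : Ω) : ψ z ≠ 1 := by
  intro hz
  set σ := kerFun Hs z (1 : ℂ) with hσ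
  -- A vector fixed by the adjoint of a contraction is fixed by the contraction. Then `s_z = ψ s_z`
  -- vanishes at `z₀`, where its value is `1`.
  have h1 : M.adjoint σ = σ := by
    rw [hσ, hM.adjoint_kerFun, hz]
    simp
  have h2 : M σ = σ := by
    refine eq_of_norm_le_re_inner_eq_norm_sq (𝕜 := ℂ) (hM1 σ) ?_
    rw [← ContinuousLinearMap.adjoint_inner_right, h1, inner_self_eq_norm_sq]
  have h3 := hM σ z₀
  rw [h2, h₀, smul_zero, hσ, kerFun_apply, hs, hs₀] at h3
  simp at h3

lemma IsFactorization.ne_one {s : Ω → Ω → ℂ} (hs : HasKernel Hs s) {z₀ : Ω}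
    (hs₀ : ∀ w, s z₀ w = 1) {F : H} {ψ : Ω → ℂ} {Φ : Ω → V}
    (h : IsFactorization Hs z₀ F ψ Φ) (z : Ω) : ψ z ≠ 1 := by
  obtain ⟨h₀, ⟨Mψ, MΦ, hMψ, -, hM⟩, -⟩ := h
  refine hMψ.ne_one hs hs₀ (fun f => ?_) h₀ z
  rw [← sq_le_sq₀ (norm_nonneg _) (norm_nonneg _)]
  linarith [hM f, sq_nonneg ‖MΦ f‖]

end Multipliers

/-! ### The kernel inequality determines `q` -/

section KernelBound

variable {Ω Hs H : Type*} [NormedAddCommGroup Hs] [InnerProductSpace ℂ Hs] [CompleteSpace Hs]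
  [RKHS ℂ Hs Ω ℂ] [NormedAddCommGroup H] [InnerProductSpace ℂ H]

/-- The positivity of `(q z + conj (q w) - 1) s z w - ⟪A z, A w⟫`, for functions
`A w = s_w F`. -/
def KernelBound (Hs : Type*) [NormedAddCommGroup Hs] [InnerProductSpace ℂ Hs] [CompleteSpace Hs]
    [RKHS ℂ Hs Ω ℂ] (A : Ω → H) (q : Ω → ℂ) : Prop :=
  ∀ x : Ω →₀ ℂ, ‖Finsupp.linearCombination ℂ A x‖ ^ 2 ≤
    2 * (⟪adjMul Hs q x, kerSum Hs x⟫_ℂ).re - ‖kerSum Hs x‖ ^ 2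

lemma KernelBound.ne_zero {s : Ω → Ω → ℂ} (hs : HasKernel Hs s) {A : Ω → H} {q : Ω → ℂ}
    (h : KernelBound Hs A q) (hpos : ∀ z, s z z ≠ 0) (z : Ω) : q z ≠ 0 := by
  intro hq
  have h1 := h (Finsupp.single z 1)
  simp only [Finsupp.linearCombination_single, adjMul_single, kerSum_single, hq, inner_zero_left,
    zero_smul, Complex.zero_re, mul_zero, zero_sub] at h1
  have h2 : ‖kerFun Hs z (1 : ℂ)‖ = 0 := by
    nlinarith [norm_nonneg (kerFun Hs z (1 : ℂ)), sq_nonneg ‖(1 : ℂ) • A z‖]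
  have h3 := hs.inner_kerFun_kerFun z z 1 1
  rw [norm_eq_zero.1 h2] at h3
  simp at h3
  exact hpos z h3.symm

lemma KernelBound.eq_inner {s : Ω → Ω → ℂ} (hs : HasKernel Hs s) {z₀ : Ω}
    (hs₀ : ∀ w, s z₀ w = 1) {F : H} (hF : ‖F‖ = 1) {A : Ω → H} (hA₀ : A z₀ = F) {q : Ω → ℂ}
    (h : KernelBound Hs A q) (hq₀ : q z₀ = 1) (w : Ω) : q w = ⟪A w, F⟫_ℂ := by
  set σ := kerFun Hs w (1 : ℂ) with hσ
  set σ₀ := kerFun Hs z₀ (1 : ℂ) with hσ₀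
  have hσσ : ⟪σ₀, σ⟫_ℂ = 1 := by rw [hσ, hσ₀, hs.inner_kerFun_kerFun, hs₀]; simp
  have hσσ' : ⟪σ, σ₀⟫_ℂ = 1 := by rw [← inner_conj_symm, hσσ]; simp
  have hσσ₀ : ⟪σ₀, σ₀⟫_ℂ = 1 := by rw [hσ₀, hs.inner_kerFun_kerFun, hs₀]; simp
  have hnσ₀ : ‖σ₀‖ ^ 2 = 1 := by
    rw [← inner_self_eq_norm_sq (𝕜 := ℂ) σ₀, hσσ₀]; simp
  -- Test the bound on `s_{z₀} + t s_w`. At `t = 0` both sides equal `1`, so the coefficient of `t`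
  -- must vanish.
  have hp : 2 * (conj (q w) - ⟪F, A w⟫_ℂ) = 0 := by
    refine eq_zero_of_forall_re_mul_add_nonneg
      (c := 2 * (q w * ⟪σ, σ⟫_ℂ).re - ‖σ‖ ^ 2 - ‖A w‖ ^ 2) fun t => ?_
    have h1 := h (Finsupp.single z₀ 1 + Finsupp.single w t)
    have hk : kerFun Hs w t = t • σ := by rw [hσ, ← map_smul, smul_eq_mul, mul_one]
    simp only [map_add, Finsupp.linearCombination_single, adjMul_single, kerSum_single, hk,
      ← hσ, ← hσ₀, hA₀, hq₀, one_smul] at h1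
    have e1 := norm_add_sq (𝕜 := ℂ) F (t • A w)
    have e2 := norm_add_sq (𝕜 := ℂ) σ₀ (t • σ)
    rw [e1, e2] at h1
    simp only [norm_smul, mul_pow, hnσ₀, hF, inner_add_left, inner_add_right, inner_smul_left,
      inner_smul_right, hσσ, hσσ', hσσ₀] at h1
    have e3 : ‖t‖ ^ 2 = t.re * t.re + t.im * t.im := Complex.sq_norm t
    rw [e3] at h1 ⊢
    simp at h1 ⊢
    nlinarith [h1]
  have h2 : conj (q w) = ⟪F, A w⟫_ℂ := by
    have := (mul_eq_zero.1 hp).resolve_left two_ne_zero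
    exact sub_eq_zero.1 this
  rw [← inner_conj_symm, ← h2, Complex.conj_conj]

end KernelBound

/-! ### Equivalence of the kernel inequality and contractivity of the column -/

section Factorization

variable {Ω E Hs HkE : Type*} [NormedAddCommGroup E] [InnerProductSpace ℂ E]
  [NormedAddCommGroup Hs] [InnerProductSpace ℂ Hs] [CompleteSpace Hs] [RKHS ℂ Hs Ω ℂ]

lemma kerFun_eq_smul_kerFun_one (z : Ω) (c : ℂ) : kerFun Hs z c = c • kerFun Hs z (1 : ℂ) := by
  rw [← map_smul, smul_eq_mul, mul_one]

/-- With `q = 1 / (1 - ψ)` and `F = q Φ`, finite sums `a`, `e` for the column `(ψ, Φ)` correspond to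
finite sums `x`, `e` for the pair `(q, F)`. -/
lemma exists_adjMul_eq_of_column {q ψ : Ω → ℂ} (hq : ∀ z, q z * (1 - ψ z) = 1) {F Φ : Ω → E}
    (hF : ∀ z, F z = q z • Φ z) (a : Ω →₀ ℂ) (e : Ω →₀ E) :
    ∃ x : Ω →₀ ℂ, kerSum Hs a = adjMul Hs F e - adjMul Hs q x ∧
      adjMul Hs ψ a + adjMul Hs Φ e = kerSum Hs a + kerSum Hs x := by
  have hq' (z : Ω) : conj (q z) * (1 - conj (ψ z)) = 1 := by
    simpa using congrArg conj (hq z)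
  have ha : ∃ x, kerSum Hs a = -adjMul Hs q x ∧ adjMul Hs ψ a = kerSum Hs a + kerSum Hs x := by
    induction a using Finsupp.induction_linear with
    | zero => exact ⟨0, by simp⟩
    | add a a' h h' =>
      obtain ⟨x, h1, h2⟩ := h
      obtain ⟨x', h1', h2'⟩ := h'
      refine ⟨x + x', ?_, ?_⟩
      · rw [map_add, h1, h1', map_add, neg_add]
      · rw [map_add, h2, h2', map_add, map_add]
        abel
    | single z c =>
      refine ⟨Finsupp.single z (-(1 - conj (ψ z)) * c), ?_, ?_⟩
      · rw [kerSum_single, adjMul_single, kerFun_eq_smul_kerFun_one, ← neg_smul]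
        congr 1
        simp only [RCLike.inner_apply]
        linear_combination -c * hq' z
      · rw [kerSum_single, kerSum_single, adjMul_single, kerFun_eq_smul_kerFun_one z c,
          kerFun_eq_smul_kerFun_one z (_ * _), ← add_smul]
        congr 1
        simp only [RCLike.inner_apply]
        ring
  have he : ∃ x, adjMul Hs F e = adjMul Hs q x ∧ adjMul Hs Φ e = kerSum Hs x := by
    induction e using Finsupp.induction_linear with
    | zero => exact ⟨0, by simp⟩
    | add e e' h h' =>
      obtain ⟨x, h1, h2⟩ := h
      obtain ⟨x', h1', h2'⟩ := h'
      exact ⟨x + x', by rw [map_add, h1, h1', map_add], by rw [map_add, h2, h2', map_add]⟩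
    | single z v =>
      refine ⟨Finsupp.single z ⟪Φ z, v⟫_ℂ, ?_, ?_⟩
      · rw [adjMul_single, adjMul_single, hF, inner_smul_left, RCLike.inner_apply, mul_comm]
      · rw [adjMul_single, kerSum_single, ← kerFun_eq_smul_kerFun_one]
  obtain ⟨x, h1, h2⟩ := ha
  obtain ⟨x', h1', h2'⟩ := he
  refine ⟨x + x', ?_, ?_⟩
  · rw [map_add, h1', h1]
    abel
  · rw [map_add, h2, h2']
    abel

/-- The same substitution solved for `a`; it is needed to pass from column contractivity to the
kernel bound. -/
lemma exists_column_of_adjMul {q ψ : Ω → ℂ} (hq : ∀ z, q z * (1 - ψ z) = 1) {F Φ : Ω → E}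
    (hF : ∀ z, F z = q z • Φ z) (x : Ω →₀ ℂ) (e : Ω →₀ E) :
    ∃ a : Ω →₀ ℂ, kerSum Hs a = adjMul Hs F e - adjMul Hs q x ∧
      adjMul Hs ψ a + adjMul Hs Φ e = kerSum Hs a + kerSum Hs x := by
  have hq' (z : Ω) : conj (q z) * (1 - conj (ψ z)) = 1 := by
    simpa using congrArg conj (hq z)
  have hx : ∃ a, kerSum Hs a = -adjMul Hs q x ∧ adjMul Hs ψ a = kerSum Hs a + kerSum Hs x := by
    induction x using Finsupp.induction_linear with
    | zero => exact ⟨0, by simp⟩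
    | add a a' h h' =>
      obtain ⟨x, h1, h2⟩ := h
      obtain ⟨x', h1', h2'⟩ := h'
      refine ⟨x + x', ?_, ?_⟩
      · rw [map_add, h1, h1', map_add, neg_add]
      · rw [map_add, h2, h2', map_add, map_add]
        abel
    | single z c =>
      refine ⟨Finsupp.single z (-conj (q z) * c), ?_, ?_⟩
      · rw [kerSum_single, adjMul_single, kerFun_eq_smul_kerFun_one, ← neg_smul]
        congr 1
        simp only [RCLike.inner_apply]
        ring
      · rw [kerSum_single, kerSum_single, adjMul_single, kerFun_eq_smul_kerFun_one z c,
          kerFun_eq_smul_kerFun_one z (_ * _), ← add_smul]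
        congr 1
        simp only [RCLike.inner_apply]
        linear_combination c * hq' z
  have he : ∃ a, kerSum Hs a = adjMul Hs F e ∧ adjMul Hs ψ a + adjMul Hs Φ e = kerSum Hs a := by
    induction e using Finsupp.induction_linear with
    | zero => exact ⟨0, by simp⟩
    | add e e' h h' =>
      obtain ⟨x, h1, h2⟩ := h
      obtain ⟨x', h1', h2'⟩ := h'
      refine ⟨x + x', by rw [map_add, h1, h1', map_add], ?_⟩
      rw [map_add, map_add, map_add, ← h2, ← h2']
      abel
    | single z v =>
      refine ⟨Finsupp.single z ⟪F z, v⟫_ℂ, ?_, ?_⟩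
      · rw [adjMul_single, kerSum_single, ← kerFun_eq_smul_kerFun_one]
      · rw [adjMul_single, adjMul_single, kerSum_single, kerFun_eq_smul_kerFun_one z ⟪F z, v⟫_ℂ,
          ← add_smul, hF, inner_smul_left, RCLike.inner_apply]
        congr 1
        linear_combination -⟪Φ z, v⟫_ℂ * hq' z
  obtain ⟨x, h1, h2⟩ := hx
  obtain ⟨x', h1', h2'⟩ := he
  refine ⟨x + x', ?_, ?_⟩
  · rw [map_add, h1', h1]
    abel
  · rw [map_add, map_add, h2, add_assoc, h2']
    abel

variable [CompleteSpace E]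
  [NormedAddCommGroup HkE] [InnerProductSpace ℂ HkE] [CompleteSpace HkE] [RKHS ℂ HkE Ω E]

lemma inner_adjMul_kerSum {s : Ω → Ω → ℂ} (hs : HasKernel Hs s) {F : HkE} {A : Ω → HkE}
    (hA : ∀ w z, A w z = s z w • F z) (e : Ω →₀ E) (x : Ω →₀ ℂ) :
    ⟪adjMul Hs F e, kerSum Hs x⟫_ℂ
      = ⟪kerSum HkE e, Finsupp.linearCombination ℂ A x⟫_ℂ := by
  refine inner_eq_inner_of_single (fun z v w c => ?_) e x
  rw [adjMul_single, kerSum_single, kerSum_single, Finsupp.linearCombination_single,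
    inner_smul_left, hs.inner_kerFun_kerFun, inner_smul_right, kerFun_inner, hA, inner_smul_right,
    inner_conj_symm]
  simp
  ring

/-- After the substitution, the required inequality is `‖X‖² + 2 Re ⟪e, Y⟫ - 2 Re ⟪Q, X⟫ ≤ ‖e‖²`
with `X`, `Y`, `Q` the sums of `s_z`, `A z`, `conj (q z) s_z` weighted by `x`; use `2 Re ⟪e, Y⟫ ≤
‖e‖² + ‖Y‖²`. -/
lemma KernelBound.isFactorization {s : Ω → Ω → ℂ} (hs : HasKernel Hs s) {F : HkE} {A : Ω → HkE}
    (hA : ∀ w z, A w z = s z w • F z) {q : Ω → ℂ} (h : KernelBound Hs A q) (hq : ∀ z, q z ≠ 0)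
    {z₀ : Ω} (hq₀ : q z₀ = 1) :
    IsFactorization Hs z₀ F (fun z => 1 - (q z)⁻¹) (fun z => (q z)⁻¹ • F z) := by
  refine ⟨by simp [hq₀], exists_column_contraction fun a e => ?_, fun z => ?_⟩
  · obtain ⟨x, hx1, hx2⟩ := exists_adjMul_eq_of_column (Hs := Hs) (q := q)
      (ψ := fun z => 1 - (q z)⁻¹) (F := F) (Φ := fun z => (q z)⁻¹ • F z)
      (fun z => by simp [hq z]) (fun z => by simp [hq z]) a e
    rw [hx2]
    have h1 := norm_add_sq_sub_eq (v := kerSum Hs x) hx1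
    rw [inner_adjMul_kerSum hs hA] at h1
    have h2 : (⟪kerSum HkE e, Finsupp.linearCombination ℂ A x⟫_ℂ).re
        ≤ ‖kerSum HkE e‖ * ‖Finsupp.linearCombination ℂ A x‖ := re_inner_le_norm (𝕜 := ℂ) _ _
    nlinarith [h x, sq_nonneg (‖kerSum HkE e‖ - ‖Finsupp.linearCombination ℂ A x‖)]
  · simp [hq z]

lemma IsFactorization.kernelBound {s : Ω → Ω → ℂ} (hs : HasKernel Hs s) {F : HkE} {A : Ω → HkE}
    (hA : ∀ w z, A w z = s z w • F z) {z₀ : Ω} {ψ : Ω → ℂ} {Φ : Ω → E}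
    (h : IsFactorization Hs z₀ F ψ Φ) (hψ : ∀ z, ψ z ≠ 1) :
    KernelBound Hs A fun z => (1 - ψ z)⁻¹ := by
  intro x
  obtain ⟨-, ⟨Mψ, MΦ, hMψ, hMΦ, hM⟩, hF⟩ := h
  have hle (e : Ω →₀ E) : 2 * (⟪kerSum HkE e, Finsupp.linearCombination ℂ A x⟫_ℂ).re
      - ‖kerSum HkE e‖ ^ 2 ≤ 2 * (⟪adjMul Hs (fun z => (1 - ψ z)⁻¹) x, kerSum Hs x⟫_ℂ).re
        - ‖kerSum Hs x‖ ^ 2 := by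
    obtain ⟨a, ha1, ha2⟩ := exists_column_of_adjMul (Hs := Hs) (q := fun z => (1 - ψ z)⁻¹)
      (F := F) (fun z => inv_mul_cancel₀ (sub_ne_zero.2 (hψ z).symm))
      (fun z => by rw [hF z, one_div]) x e
    have h1 := norm_add_sq_sub_eq (v := kerSum Hs x) ha1
    have h2 := norm_sq_adjMul_add_le hMψ hMΦ hM a e
    rw [inner_adjMul_kerSum hs hA] at h1
    rw [ha2] at h2
    linarith
  -- Density allows arbitrary `y`; the left side is largest when `y` is the combination of the `A
  -- z`, which gives the bound.
  have hle' (y : HkE) : 2 * (⟪y, Finsupp.linearCombination ℂ A x⟫_ℂ).re - ‖y‖ ^ 2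
      ≤ 2 * (⟪adjMul Hs (fun z => (1 - ψ z)⁻¹) x, kerSum Hs x⟫_ℂ).re - ‖kerSum Hs x‖ ^ 2 :=
    (denseRange_kerSum HkE).induction_on (p := fun y =>
      2 * (⟪y, Finsupp.linearCombination ℂ A x⟫_ℂ).re - ‖y‖ ^ 2
      ≤ 2 * (⟪adjMul Hs (fun z => (1 - ψ z)⁻¹) x, kerSum Hs x⟫_ℂ).re - ‖kerSum Hs x‖ ^ 2) y
      (isClosed_le (by fun_prop) continuous_const) hle
  have h1 := hle' (Finsupp.linearCombination ℂ A x)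
  have h2 : (⟪Finsupp.linearCombination ℂ A x, Finsupp.linearCombination ℂ A x⟫_ℂ).re
      = ‖Finsupp.linearCombination ℂ A x‖ ^ 2 := inner_self_eq_norm_sq (𝕜 := ℂ) _
  rw [h2] at h1
  linarith

end Factorization

/-- A normalized complete Nevanlinna-Pick kernel is `1 / (1 - ⟪b z, b w⟫)` for a map `b` into the
open unit ball that vanishes at the base point. -/
lemma IsNormalizedCNP.exists_ball {Ω : Type*} {s : Ω → Ω → ℂ} {z₀ : Ω}
    (h : IsNormalizedCNP s z₀) : ∃ b : Ω → lp (fun _ : ℕ => ℂ) 2, b z₀ = 0 ∧ (∀ z, ‖b z‖ < 1) ∧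
      (∀ z w, s z w * (1 - ⟪b z, b w⟫_ℂ) = 1) := by
  obtain ⟨u, hu₀, hu, hs⟩ := h
  have hnorm (z : Ω) : ‖star (u z)‖ < 1 := by
    rw [norm_star]; exact hu z
  -- Conjugating `u` moves `z` to the first slot, as in a Gram kernel.
  have hinner (z w : Ω) : ⟪star (u z), star (u w)⟫_ℂ = ⟪u w, u z⟫_ℂ := by
    rw [lp.inner_eq_tsum, lp.inner_eq_tsum]
    refine tsum_congr fun n => ?_
    simp [mul_comm]
  refine ⟨fun z => star (u z), by simp [hu₀], hnorm, fun z w => ?_⟩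
  have hlt : ‖⟪u w, u z⟫_ℂ‖ < 1 := by
    refine (norm_inner_le_norm _ _).trans_lt ?_
    nlinarith [hu z, hu w, norm_nonneg (u z), norm_nonneg (u w)]
  have hne : 1 - ⟪u w, u z⟫_ℂ ≠ 0 := by
    intro h
    rw [← sub_eq_zero.1 h] at hlt
    simp at hlt
  rw [hinner, hs, one_div, inv_mul_cancel₀ hne]

/-! ### Existence of the factorization and equality of generated subspaces -/

section

variable {Ω E Hs Hk HkE : Type*} [NormedAddCommGroup E] [InnerProductSpace ℂ E] [CompleteSpace E]
  [NormedAddCommGroup Hs] [InnerProductSpace ℂ Hs] [CompleteSpace Hs] [RKHS ℂ Hs Ω ℂ]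
  [NormedAddCommGroup Hk] [InnerProductSpace ℂ Hk] [CompleteSpace Hk] [RKHS ℂ Hk Ω ℂ]
  [NormedAddCommGroup HkE] [InnerProductSpace ℂ HkE] [CompleteSpace HkE] [RKHS ℂ HkE Ω E]

lemma exists_kernelBound {B G : Type*} [NormedAddCommGroup B] [InnerProductSpace ℂ B]
    [NormedAddCommGroup G] [InnerProductSpace ℂ G] {s k : Ω → Ω → ℂ} (hs : HasKernel Hs s)
    (hkE : HasKernel HkE k) {b : Ω → B} (hb : ∀ z, ‖b z‖ < 1)
    (hsb : ∀ z w, s z w * (1 - ⟪b z, b w⟫_ℂ) = 1) {γ : Ω → G}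
    (hγ : ∀ z w, k z w = s z w * ⟪γ z, γ w⟫_ℂ) {F : HkE} (hF : ‖F‖ = 1) :
    ∃ A : Ω → HkE, (∀ w z, A w z = s z w • F z) ∧ KernelBound Hs A fun z => ⟪A z, F⟫_ℂ := by
  obtain ⟨P, hP, hPz⟩ := exists_row_contraction hkE (b := b) (γ := γ) fun z w => by
    rw [hγ]; linear_combination ⟪γ z, γ w⟫_ℂ * hsb z w
  obtain ⟨A, hA⟩ := exists_sub_apply_tmul_eq hP hb F
  refine ⟨A, fun w z => ?_, fun x => ?_⟩
  · rw [← hA w, coe_sub, Pi.sub_apply, hPz]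
    nth_rw 2 [← one_smul ℂ (A w z)]
    rw [← sub_smul, smul_smul, hsb, one_smul]
  · have h := norm_sq_linearCombination_le (σ := fun z => kerFun Hs z (1 : ℂ))
      (ξ := fun z => b z ⊗ₜ A z) hP hF hA (fun z w => by
        rw [hs.inner_kerFun_kerFun, TensorProduct.inner_tmul]
        simp only [inner_self_eq_norm_sq_to_K, norm_one, Complex.coe_algebraMap, Complex.ofReal_one]
        linear_combination ⟪A z, A w⟫_ℂ * hsb z w) x
    have h1 : kerSum Hs = Finsupp.linearCombination ℂ (fun z => kerFun Hs z (1 : ℂ)) :=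
      Finsupp.lhom_ext fun z c => by simp [← kerFun_eq_smul_kerFun_one]
    have h2 : adjMul Hs (fun z => ⟪A z, F⟫_ℂ)
        = Finsupp.linearCombination ℂ (fun z => ⟪F, A z⟫_ℂ • kerFun Hs z (1 : ℂ)) :=
      Finsupp.lhom_ext fun z c => by simp [smul_smul]
    rw [h1, h2]
    exact h

/-- The factor result applies with `k` itself as the scalar kernel and trivial second factor `γ =
1`. -/
lemma multiplier_acts {k : Ω → Ω → ℂ} (hk : HasKernel Hk k) (hkE : HasKernel HkE k) (φ : Ω → ℂ)
    (hφ : IsMultiplier Hk Hk φ) : ∃ T : HkE →L[ℂ] HkE, ∀ f z, T f z = φ z • f z := by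
  obtain ⟨M, hM⟩ := hφ
  obtain ⟨T, -, hT⟩ := hM.exists_isMulOp_of_kernel_mul hk hkE (γ := fun _ => (1 : ℂ))
    fun z w => by simp
  exact ⟨T, hT⟩

lemma IsFactorization.multSpan_eq {G : Type*} [NormedAddCommGroup G] [InnerProductSpace ℂ G]
    {s k : Ω → Ω → ℂ} (hs : HasKernel Hs s) (hk : HasKernel Hk k)
    (hkE : HasKernel HkE k) {γ : Ω → G} (hγ : ∀ z w, k z w = s z w * ⟪γ z, γ w⟫_ℂ) {z₀ : Ω}
    (hs₀ : ∀ w, s z₀ w = 1) (hs₀' : ∀ w, s w z₀ = 1) {F : HkE} {ψ : Ω → ℂ} {Φ : Ω → E}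
    (h : IsFactorization Hs z₀ F ψ Φ) :
    ∃ Φ' : HkE, ⇑Φ' = Φ ∧ multSpan Hk {F} = multSpan Hk {Φ'} := by
  have hψ := h.ne_one hs hs₀
  obtain ⟨-, ⟨Mψ, MΦ, hMψ, hMΦ, hM⟩, hF⟩ := h
  have hMψ1 : ‖Mψ‖ ≤ 1 := by
    refine ContinuousLinearMap.opNorm_le_bound _ zero_le_one fun f => ?_
    rw [one_mul, ← sq_le_sq₀ (norm_nonneg _) (norm_nonneg _)]
    linarith [hM f, sq_nonneg ‖MΦ f‖]
  have hψk : IsMultiplier Hk Hk ψ := by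
    obtain ⟨M, -, hM⟩ := hMψ.exists_isMulOp_of_kernel_mul hs hk hγ
    exact ⟨M, fun f z => by rw [hM, smul_eq_mul, smul_eq_mul, mul_comm]⟩
  obtain ⟨T, hT1, hT⟩ := hMψ.exists_isMulOp_of_kernel_mul hs hkE hγ
  have hinv (S : Set HkE) := isMultInvariant_multSpan (Hk := Hk) (multiplier_acts hk hkE) S
  -- Normalization makes `s_{z₀}` the constant function `1`, so its image under `MΦ` is `Φ`.
  let Φ' : HkE := MΦ (kerFun Hs z₀ (1 : ℂ))
  have hΦ' : ⇑Φ' = Φ := by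
    ext z
    rw [hMΦ, kerFun_apply, hs, hs₀']
    simp
  have hΦF (z : Ω) : Φ z = (1 - ψ z) • F z := by
    rw [hF, smul_smul, mul_one_div_cancel (sub_ne_zero.2 (hψ z).symm), one_smul]
  refine ⟨Φ', hΦ', le_antisymm (multSpan_le (hinv _) ?_) (multSpan_le (hinv _) ?_)⟩
  · rw [Set.singleton_subset_iff]
    refine mem_of_sub_apply_mem (hT1.trans hMψ1) (fun G hG => ?_) (hinv {Φ'}).1
      (fun G hG => ?_) ?_
    · ext z
      have h1 : G z = ψ z • G z := by rw [← hT, hG]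
      have h2 : (1 - ψ z) • G z = 0 := by rw [sub_smul, one_smul, ← h1, sub_self]
      simpa using (smul_eq_zero.1 h2).resolve_left (sub_ne_zero.2 (hψ z).symm)
    · obtain ⟨G', hG', h⟩ := (hinv {Φ'}).2 ψ hψk G hG
      rwa [show T G = G' from RKHS.ext fun z => (hT G z).trans (h z).symm]
    · have h1 : F - T F = Φ' := by
        ext z
        rw [hΦ', hΦF, coe_sub, Pi.sub_apply, hT, sub_smul, one_smul]
      rw [h1]
      exact subset_multSpan _ rfl
  · rw [Set.singleton_subset_iff]
    obtain ⟨G', hG', h⟩ := (hinv {F}).2 _ hψk.one_sub F (subset_multSpan _ rfl)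
    rw [show Φ' = G' from RKHS.ext fun z => by rw [hΦ', hΦF, h]]
    exact hG'

end

theorem corollary4 {Ω E Hs Hk HkE : Type*}
    [NormedAddCommGroup E] [InnerProductSpace ℂ E] [CompleteSpace E]
    [TopologicalSpace.SeparableSpace E]
    [NormedAddCommGroup Hs] [InnerProductSpace ℂ Hs] [CompleteSpace Hs] [RKHS ℂ Hs Ω ℂ]
    [NormedAddCommGroup Hk] [InnerProductSpace ℂ Hk] [CompleteSpace Hk] [RKHS ℂ Hk Ω ℂ]
    [NormedAddCommGroup HkE] [InnerProductSpace ℂ HkE] [CompleteSpace HkE] [RKHS ℂ HkE Ω E]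
    (z₀ : Ω) (s k : Ω → Ω → ℂ)
    (hs : HasKernel Hs s) (hk : HasKernel Hk k) (hkE : HasKernel HkE k)
    (hcnp : IsNormalizedCNP s z₀)
    (hfactor : ∃ g : Ω → Ω → ℂ, IsPosDefKernel g ∧ ∀ z w, k z w = s z w * g z w) :
    (∀ F : HkE, ‖F‖ = 1 →
      (∃! p : (Ω → ℂ) × (Ω → E), IsFactorization Hs z₀ F p.1 p.2) ∧
      ∀ (ψ : Ω → ℂ) (Φ : Ω → E), IsFactorization Hs z₀ F ψ Φ →
        ∃ Φ' : HkE, ⇑Φ' = Φ ∧ multSpan Hk {F} = multSpan Hk {Φ'}) ∧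
    (∀ N : Submodule ℂ HkE, IsMultInvariant Hk N →
      ∃ S : Set HkE, (∀ Φ ∈ S, IsMultiplier Hs HkE ⇑Φ) ∧ N = multSpan Hk S) := by
  obtain ⟨b, hb₀, hb, hsb⟩ := hcnp.exists_ball
  obtain ⟨g, hg, hkg⟩ := hfactor
  obtain ⟨G, _, _, γ, hγ⟩ := hg.exists_gram
  simp only [hγ] at hkg
  have hs₀ (w : Ω) : s z₀ w = 1 := by simpa [hb₀] using hsb z₀ w
  have hs₀' (w : Ω) : s w z₀ = 1 := by simpa [hb₀] using hsb w z₀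
  have hspos (z : Ω) : s z z ≠ 0 := fun h => by simpa [h] using hsb z z
  have hfac (F : HkE) (hF : ‖F‖ = 1) :
      ∃! p : (Ω → ℂ) × (Ω → E), IsFactorization Hs z₀ F p.1 p.2 := by
    obtain ⟨A, hA, hAb⟩ := exists_kernelBound hs hkE hb hsb hkg hF
    have hA₀ : A z₀ = F := RKHS.ext fun z => by rw [hA, hs₀', one_smul]
    have hq₀ : ⟪A z₀, F⟫_ℂ = 1 := by rw [hA₀, inner_self_eq_norm_sq_to_K, hF]; simp
    have hq := hAb.ne_zero hs hspos
    refine ⟨(_, _), hAb.isFactorization hs hA hq hq₀, fun p hp => ?_⟩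
    have hψ := hp.ne_one hs hs₀
    have hqw := (hp.kernelBound hs hA hψ).eq_inner hs hs₀ hF hA₀ (by simp [hp.1])
    have h1 (z : Ω) : p.1 z = 1 - (⟪A z, F⟫_ℂ)⁻¹ := by
      rw [← hqw z, inv_inv]; ring
    refine Prod.ext (funext h1) (funext fun z => ?_)
    simp only [hp.2.2 z, ← hqw z, one_div, inv_inv, smul_smul]
    rw [mul_inv_cancel₀ (sub_ne_zero.2 (hψ z).symm), one_smul]
  have hgen (F : HkE) (ψ : Ω → ℂ) (Φ : Ω → E) (h : IsFactorization Hs z₀ F ψ Φ) :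
      ∃ Φ' : HkE, ⇑Φ' = Φ ∧ multSpan Hk {F} = multSpan Hk {Φ'} :=
    h.multSpan_eq hs hk hkE hkg hs₀ hs₀'
  refine ⟨fun F hF => ⟨hfac F hF, hgen F⟩, fun N hN => ?_⟩
  have hinv (S : Set HkE) := isMultInvariant_multSpan (Hk := Hk) (multiplier_acts hk hkE) S
  -- The largest possible generating set: all multipliers lying in `N`.
  refine ⟨{Φ | Φ ∈ N ∧ IsMultiplier Hs HkE ⇑Φ}, fun Φ hΦ => hΦ.2,
    le_antisymm (fun F hF => ?_) (multSpan_le hN fun Φ hΦ => hΦ.1)⟩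
  rcases eq_or_ne F 0 with rfl | hF0
  · exact Submodule.zero_mem _
  set F₁ : HkE := ((‖F‖ : ℂ)⁻¹) • F with hF₁
  have hF₁N : F₁ ∈ N := N.smul_mem _ hF
  obtain ⟨p, hp, -⟩ := hfac F₁ (by simp [hF₁, norm_smul, hF0])
  obtain ⟨Φ, hΦ, hspan⟩ := hgen F₁ p.1 p.2 hp
  have hΦN : Φ ∈ N := by
    have h1 : multSpan Hk {F₁} ≤ N := multSpan_le hN (Set.singleton_subset_iff.2 hF₁N)
    exact h1 (hspan ▸ subset_multSpan {Φ} rfl)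
  obtain ⟨-, ⟨-, MΦ, -, hMΦ, -⟩, -⟩ := hp
  have hΦS : IsMultiplier Hs HkE ⇑Φ := ⟨MΦ, hΦ ▸ hMΦ⟩
  have hΦmem : Φ ∈ {Φ : HkE | Φ ∈ N ∧ IsMultiplier Hs HkE ⇑Φ} := ⟨hΦN, hΦS⟩
  have h1 : F₁ ∈ multSpan Hk {Φ | Φ ∈ N ∧ IsMultiplier Hs HkE ⇑Φ} := by
    have h2 : F₁ ∈ multSpan Hk {Φ} := hspan ▸ subset_multSpan {F₁} rfl
    exact multSpan_le (hinv _)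
      (Set.singleton_subset_iff.2 (subset_multSpan _ hΦmem)) h2
  have h3 : F = (‖F‖ : ℂ) • F₁ := by
    rw [hF₁, smul_smul, mul_inv_cancel₀ (by simpa using hF0), one_smul]
  rw [h3]
  exact Submodule.smul_mem _ _ h1
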